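/- A numerical semigroup is a submonoid $S$ of $(\mathbb{N},+)$ such that $\mathbb{N}\setminus S$ is finite. Let $\operatorname{msg}(S)$ denote the unique minimal system of generators of $S$ (it is finite), and let $\operatorname{e}(S)$ be its cardinality. A numerical semigroup $T$ is a multiple of $S$ if there is an integer $d\ge 1$ with $S=\{x\in\mathbb{N}\mid d\,x\in T\}$. The quotient rank of $S$ is $\min\{\operatorname{e}(T)\mid T \text{ is a numerical semigroup that is a multiple of } S\}$, and $S$ has full quotient rank if its quotient rank equals $\operatorname{e}(S)$. For $n\in S$, where $\operatorname{msg}(S)=\{a_1,\ldots,a_e\}$, let $\nabla_n$ be the graph whose vertices are the factorizations of $n$, that is, the $u\in\mathbb{N}^e$ with $\sum_{i=1}^e u_i a_i=n$, two distinct factorizations $u,v$ being adjacent when $u_i\neq 0\neq v_i$ for some $i$. The element $n\in S$ is a Betti element of $S$ if $\nabla_n$ is not connected. **Corollary.** If $S$ is a numerical semigroup with a unique (that is, exactly one) Betti element, then $S$ has full quotient rank. -/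

import Mathlib

namespace NumSemigroup

/-- A numerical semigroup: a submonoid of `(ℕ, +)` with finite complement in `ℕ`. -/
def IsNumericalSemigroup (S : AddSubmonoid ℕ) : Prop :=
  ((S : Set ℕ)ᶜ).Finite

/-- `A` is a minimal system of generators of `S`: it generates `S`, and no proper subset of `A`
generates `S`. -/
def IsMinimalSystemOfGenerators (S : AddSubmonoid ℕ) (A : Set ℕ) : Prop :=
  AddSubmonoid.closure A = S ∧ ∀ B : Set ℕ, B ⊂ A → AddSubmonoid.closure B ≠ S

/-- The minimal system of generators `msg(S)`: the nonzero elements of `S` that are not a sum of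
two nonzero elements of `S`. By `isMinimalSystemOfGenerators_iff` below, this is the one and only
minimal system of generators of `S`; by `msg_finite` it is finite. -/
def msg (S : AddSubmonoid ℕ) : Set ℕ :=
  {a | a ∈ S ∧ a ≠ 0 ∧ ∀ b ∈ S, ∀ c ∈ S, a = b + c → b = 0 ∨ c = 0}

/-- The embedding dimension `e(S)`: the number of minimal generators. -/
noncomputable def embDim (S : AddSubmonoid ℕ) : ℕ :=
  (msg S).ncard

/-- The quotient `T / d = {x ∈ ℕ | d x ∈ T}`. -/
def quotient (T : AddSubmonoid ℕ) (d : ℕ) : AddSubmonoid ℕ where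
  carrier := {x | d * x ∈ T}
  zero_mem' := by simp
  add_mem' := by
    intro a b ha hb
    simpa [Nat.mul_add] using T.add_mem ha hb

/-- `T` is a multiple of `S`: `T / d = S` for some positive integer `d`. -/
def IsMultiple (T S : AddSubmonoid ℕ) : Prop :=
  ∃ d : ℕ, d ≠ 0 ∧ quotient T d = S

/-- The set of embedding dimensions `e(T)` of the numerical semigroups `T` that are multiples
of `S`. -/
def multipleEmbDims (S : AddSubmonoid ℕ) : Set ℕ :=
  {k | ∃ T : AddSubmonoid ℕ, IsNumericalSemigroup T ∧ IsMultiple T S ∧ embDim T = k}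

/-- The quotient rank `min {e(T) | T is a multiple of S}` of a numerical semigroup `S`
(the minimum exists, see `quotientRank_isLeast`). -/
noncomputable def quotientRank (S : AddSubmonoid ℕ) : ℕ :=
  sInf (multipleEmbDims S)

/-- `S` has full quotient rank: its quotient rank equals its embedding dimension. -/
def HasFullQuotientRank (S : AddSubmonoid ℕ) : Prop :=
  quotientRank S = embDim S

/-- The set `Z(n)` of factorizations of `n` in `S`: the families `u` of natural numbers indexed by
the minimal generators `a` of `S` (finitely many) with `∑ u_a a = n`. -/
def factorizations (S : AddSubmonoid ℕ) (n : ℕ) : Set (msg S →₀ ℕ) :=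
  {u | (u.sum fun a k => k * (a : ℕ)) = n}

/-- The graph `∇_n` of factorizations of `n`: two distinct factorizations are joined by an edge
when some minimal generator occurs in both of them. -/
def factorizationGraph (S : AddSubmonoid ℕ) (n : ℕ) : SimpleGraph (factorizations S n) where
  Adj u v := u ≠ v ∧ ∃ a : msg S, u.1 a ≠ 0 ∧ v.1 a ≠ 0
  symm := ⟨fun _ _ ⟨h, a, hu, hv⟩ => ⟨h.symm, a, hv, hu⟩⟩
  loopless := ⟨fun _ h => h.1 rfl⟩

/-- The Betti elements of `S`: the `n ∈ S` whose graph `∇_n` is not connected. -/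
def bettiElements (S : AddSubmonoid ℕ) : Set ℕ :=
  {n | n ∈ S ∧ ¬ (factorizationGraph S n).Connected}

/-- `S` has a unique Betti element. -/
def HasUniqueBettiElement (S : AddSubmonoid ℕ) : Prop :=
  ∃! n : ℕ, n ∈ bettiElements S

theorem closure_msg (S : AddSubmonoid ℕ) : AddSubmonoid.closure (msg S) = S := by
  apply le_antisymm
  · exact (AddSubmonoid.closure_le).2 fun a ha => ha.1
  · intro n hn
    induction n using Nat.strong_induction_on with
    | _ n ih =>
      by_cases h : n ∈ msg S
      · exact AddSubmonoid.subset_closure h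
      · by_cases h0 : n = 0
        · subst h0; exact zero_mem _
        · simp only [msg, Set.mem_ofPred_eq, not_and, not_forall, not_or] at h
          obtain ⟨b, hb, c, hc, rfl, hb0, hc0⟩ := h hn h0
          exact add_mem (ih b (by omega) hb) (ih c (by omega) hc)

theorem msg_subset_of_closure_eq {S : AddSubmonoid ℕ} {A : Set ℕ}
    (h : AddSubmonoid.closure A = S) : msg S ⊆ A := by
  subst h
  intro a ha
  suffices H : ∀ x ∈ AddSubmonoid.closure A, x ∈ msg (AddSubmonoid.closure A) → x ∈ A from
    H a ha.1 ha
  intro x hx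
  induction hx using AddSubmonoid.closure_induction with
  | mem x hx => exact fun _ => hx
  | zero => exact fun h => absurd rfl h.2.1
  | add x y hx hy ihx ihy =>
    intro h
    rcases h.2.2 x hx y hy rfl with h0 | h0
    · subst h0; rw [zero_add] at h ⊢; exact ihy h
    · subst h0; rw [add_zero] at h ⊢; exact ihx h

theorem isMinimalSystemOfGenerators_iff (S : AddSubmonoid ℕ) (A : Set ℕ) :
    IsMinimalSystemOfGenerators S A ↔ A = msg S := by
  constructor
  · rintro ⟨h1, h2⟩
    by_contra hne
    exact h2 (msg S) ((msg_subset_of_closure_eq h1).ssubset_of_ne (Ne.symm hne)) (closure_msg S)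
  · rintro rfl
    exact ⟨closure_msg S, fun B hB h => hB.2 (msg_subset_of_closure_eq h)⟩

theorem msg_finite (S : AddSubmonoid ℕ) : (msg S).Finite := by
  obtain ⟨A, hA⟩ := Nat.addSubmonoid_fg S
  exact A.finite_toSet.subset (msg_subset_of_closure_eq hA)

theorem quotientRank_isLeast {S : AddSubmonoid ℕ} (hS : IsNumericalSemigroup S) :
    IsLeast (multipleEmbDims S) (quotientRank S) := by
  have hne : (multipleEmbDims S).Nonempty :=
    ⟨embDim S, S, hS, ⟨1, one_ne_zero, by ext x; simp [quotient]⟩, rfl⟩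
  exact ⟨Nat.sInf_mem hne, fun k hk => Nat.sInf_le hk⟩

end NumSemigroup

/-! Let `b` be the only Betti element. Each minimal generator `a` satisfies `k_a a = b` with `k_a ≥
2`, and coefficients in factorizations of one element are determined modulo `k_a`
(`exists_modEq_of_hasUniqueBettiElement`). Suppose `S = T / d` with `e(T) < e(S)`. Writing each `d
a` in the generators of `T` gives too many vectors `V_a`, hence a relation `∑ g_a k_a V_a = 0` with
some `g_a` odd (`exists_odd_relation`); then `∑ g_a = 0`. Halve it, rounding each coefficient up to
`c_a = ⌊g_a/2⌋ k_a + m_a` with `0 ≤ m_a < k_a`. Since `∑ c_a V_a ≥ 0`, the integer `x = ∑ c_a a`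
lies in `S`. The congruences force every factorization of `x` to dominate `m`, yet `x = ∑ m_a a + b
∑ ⌊g_a/2⌋` is less than `∑ m_a a`. -/

namespace NumSemigroup

/-! ### Factorizations and their values -/

/-- The value `∑ u_a a` of a family of coefficients indexed by the minimal generators. -/
noncomputable def factorizationValue (S : AddSubmonoid ℕ) : (msg S →₀ ℕ) →ₗ[ℕ] ℕ :=
  Finsupp.linearCombination ℕ (Subtype.val : msg S → ℕ)

theorem factorizationValue_single (S : AddSubmonoid ℕ) (a : msg S) (k : ℕ) :
    factorizationValue S (Finsupp.single a k) = k * a := by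
  simp [factorizationValue]

theorem mem_factorizations_iff {S : AddSubmonoid ℕ} {n : ℕ} {u : msg S →₀ ℕ} :
    u ∈ factorizations S n ↔ factorizationValue S u = n := Iff.rfl

theorem mem_iff_exists_factorization {S : AddSubmonoid ℕ} {n : ℕ} :
    n ∈ S ↔ ∃ u, factorizationValue S u = n := by
  have h : n ∈ Submodule.span ℕ (Set.range (Subtype.val : msg S → ℕ)) ↔ n ∈ S := by
    rw [Subtype.range_coe, ← Submodule.mem_toAddSubmonoid,
      Submodule.span_nat_eq_addSubmonoidClosure, closure_msg]
  rw [← h, ← Finsupp.range_linearCombination]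
  exact Iff.rfl

theorem msg_pos {S : AddSubmonoid ℕ} (a : msg S) : 0 < (a : ℕ) := Nat.pos_of_ne_zero a.2.2.1

theorem factorizationValue_eq_zero_iff {S : AddSubmonoid ℕ} {u : msg S →₀ ℕ} :
    factorizationValue S u = 0 ↔ u = 0 := by
  refine ⟨fun h => ?_, fun h => by rw [h, map_zero]⟩
  change (u.sum fun a k => k * (a : ℕ)) = 0 at h
  rw [Finsupp.sum, Finset.sum_eq_zero_iff] at h
  ext a
  by_contra ha
  have := h a (Finsupp.mem_support_iff.2 ha)
  exact ha (by simpa [(msg_pos a).ne'] using this)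

theorem exists_eq_add_single {S : AddSubmonoid ℕ} {u : msg S →₀ ℕ} {a : msg S} (h : u a ≠ 0) :
    ∃ w, u = w + Finsupp.single a 1 :=
  ⟨u - Finsupp.single a 1, (tsub_add_cancel_of_le (by
    rw [Finsupp.single_le_iff]; omega)).symm⟩

theorem factorizationValue_add_single {S : AddSubmonoid ℕ} (w : msg S →₀ ℕ) (a : msg S) :
    factorizationValue S (w + Finsupp.single a 1) = factorizationValue S w + a := by
  rw [map_add, factorizationValue_single, one_mul]

/-- A minimal generator has only one factorization. -/
theorem eq_single_of_factorizationValue_eq_msg {S : AddSubmonoid ℕ} {v : msg S →₀ ℕ} {a : msg S}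
    (h : factorizationValue S v = a) : v = Finsupp.single a 1 := by
  have hv : v ≠ 0 := by
    rintro rfl
    rw [map_zero] at h
    exact (msg_pos a).ne h
  obtain ⟨c, hc⟩ := Finsupp.ne_iff.1 hv
  obtain ⟨w, rfl⟩ := exists_eq_add_single hc
  rw [factorizationValue_add_single] at h
  rcases a.2.2.2 _ (mem_iff_exists_factorization.2 ⟨w, rfl⟩) _ c.2.1 h.symm with h0 | h0
  · rw [h0, zero_add] at h
    rw [factorizationValue_eq_zero_iff.1 h0, Subtype.ext h, zero_add]
  · exact absurd h0 (msg_pos c).ne'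

/-! ### Betti elements and congruences between factorizations -/

/-- A relation on factorizations that holds between equal ones and at disconnected values, and
that may be checked after cancelling a common generator, holds between any two factorizations of
the same element. -/
theorem factorization_induction {S : AddSubmonoid ℕ} {r : (msg S →₀ ℕ) → (msg S →₀ ℕ) → Prop}
    (hr : Equivalence r) (hadd : ∀ u v w, r u v → r (u + w) (v + w)) (N : ℕ)
    (hbetti : ∀ n ∈ bettiElements S, n < N → ∀ u v, factorizationValue S u = n →
      factorizationValue S v = n → r u v) :
    ∀ n < N, ∀ u v, factorizationValue S u = n → factorizationValue S v = n → r u v := by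
  intro n
  induction n using Nat.strong_induction_on with
  | _ n ih =>
    intro hn u v hu hv
    by_cases hb : n ∈ bettiElements S
    · exact hbetti n hb hn u v hu hv
    have hc : (factorizationGraph S n).Connected := by
      by_contra hc
      exact hb ⟨mem_iff_exists_factorization.2 ⟨u, hu⟩, hc⟩
    -- Adjacent factorizations share a generator; cancelling it leaves two factorizations of a
    -- smaller element.
    have key : ∀ x y : factorizations S n, (factorizationGraph S n).Walk x y → r x.1 y.1 := by
      intro x y p
      induction p with
      | nil => exact hr.refl _
      | cons h p ihp =>
        refine hr.trans ?_ ihp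
        rename_i x y z
        obtain ⟨-, a, hx, hy⟩ := h
        obtain ⟨x', hx'⟩ := exists_eq_add_single hx
        obtain ⟨y', hy'⟩ := exists_eq_add_single hy
        have h1 := mem_factorizations_iff.1 x.2
        have h2 := mem_factorizations_iff.1 y.2
        rw [hx', factorizationValue_add_single] at h1
        rw [hy', factorizationValue_add_single] at h2
        rw [hx', hy']
        have := msg_pos a
        exact hadd _ _ _ (ih (factorizationValue S x') (by omega) (by omega) x' y' rfl (by omega))
    obtain ⟨p⟩ := hc.preconnected ⟨u, hu⟩ ⟨v, hv⟩
    exact key _ _ p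

/-- Below all Betti elements, factorizations are unique. -/
theorem factorization_unique {S : AddSubmonoid ℕ} {b : ℕ} (hb : ∀ n ∈ bettiElements S, b ≤ n)
    {u v : msg S →₀ ℕ} (hu : factorizationValue S u < b)
    (h : factorizationValue S u = factorizationValue S v) : u = v :=
  factorization_induction (r := Eq) ⟨fun _ => rfl, Eq.symm, Eq.trans⟩
    (fun _ _ _ h => by rw [h]) b (fun n hn hlt => absurd (hb n hn) (by omega)) _ hu u v rfl h.symm

/-- A semigroup with a Betti element has at least two minimal generators. -/
theorem exists_ne_of_mem_bettiElements {S : AddSubmonoid ℕ} {b : ℕ} (hb : b ∈ bettiElements S)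
    (a : msg S) : ∃ c : msg S, c ≠ a := by
  by_contra! hall
  obtain ⟨u, hu⟩ := mem_iff_exists_factorization.1 hb.1
  have : Nonempty (factorizations S b) := ⟨⟨u, hu⟩⟩
  have hsing : ∀ v : msg S →₀ ℕ, v = Finsupp.single a (v a) := by
    intro v
    ext c
    rw [hall c, Finsupp.single_eq_same]
  have : Subsingleton (factorizations S b) := by
    refine ⟨fun x y => Subtype.ext ?_⟩
    have h := (mem_factorizations_iff.1 x.2).trans (mem_factorizations_iff.1 y.2).symm
    rw [hsing x.1, hsing y.1, factorizationValue_single, factorizationValue_single] at h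
    rw [hsing x.1, hsing y.1, Nat.eq_of_mul_eq_mul_right (msg_pos a) h]
  exact hb.2 { preconnected := SimpleGraph.Preconnected.of_subsingleton }

/-- In a semigroup with a Betti element, every minimal generator has a multiple, not equal to
itself, that is a Betti element. -/
theorem exists_mul_mem_bettiElements {S : AddSubmonoid ℕ} {b : ℕ} (hb : b ∈ bettiElements S)
    (a : msg S) : ∃ k, 2 ≤ k ∧ k * (a : ℕ) ∈ bettiElements S := by
  classical
  obtain ⟨c, hc⟩ := exists_ne_of_mem_bettiElements hb a
  -- Take the least multiple of `a` with a second factorization; one exists because `c * a` is also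
  -- `a` copies of `c`.
  have hex : ∃ k, ∃ v, factorizationValue S v = k * (a : ℕ) ∧ v ≠ Finsupp.single a k := by
    refine ⟨c, Finsupp.single c a, by rw [factorizationValue_single, mul_comm], fun h => ?_⟩
    have := DFunLike.congr_fun h c
    rw [Finsupp.single_eq_same, Finsupp.single_eq_of_ne hc] at this
    exact (msg_pos a).ne' this
  obtain ⟨v, hv, hne⟩ := Nat.find_spec hex
  have hmin := fun m => Nat.find_min (m := m) hex
  generalize Nat.find hex = k at hv hne hmin
  have hk : 2 ≤ k := by
    by_contra! hk
    interval_cases k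
    · rw [zero_mul, factorizationValue_eq_zero_iff] at hv
      exact hne (by rw [hv, Finsupp.single_zero])
    · rw [one_mul] at hv
      exact hne (eq_single_of_factorizationValue_eq_msg hv)
  refine ⟨k, hk, mem_iff_exists_factorization.2 ⟨v, hv⟩, fun hconn => ?_⟩
  -- The vertex `single a k` is isolated: a neighbour would contain `a`, and cancelling it would
  -- contradict the minimality of `k`.
  obtain ⟨p⟩ := hconn.preconnected ⟨Finsupp.single a k, factorizationValue_single S a k⟩ ⟨v, hv⟩
  cases p with
  | nil => exact hne rfl
  | @cons _ w _ h p =>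
    obtain ⟨hne', c, hc, hw⟩ := h
    have hca : c = a := by
      by_contra hca
      exact hc (Finsupp.single_eq_of_ne hca)
    subst hca
    obtain ⟨w', hw'⟩ := exists_eq_add_single hw
    have h1 := mem_factorizations_iff.1 w.2
    rw [hw', factorizationValue_add_single] at h1
    obtain ⟨j, rfl⟩ : ∃ j, k = j + 1 := ⟨k - 1, by omega⟩
    refine hmin j (by omega) ⟨w', by rw [add_mul] at h1; omega, fun h => hne' (Subtype.ext ?_)⟩
    rw [hw', h, ← Finsupp.single_add]

/-- If `b` is the only Betti element, there are `k_a ≥ 2` with `k_a a = b` for each minimal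
generator `a`, such that the coefficients of `a` in any two factorizations of an element are
congruent modulo `k_a`. -/
theorem exists_modEq_of_hasUniqueBettiElement {S : AddSubmonoid ℕ} (h : HasUniqueBettiElement S) :
    ∃ (b : ℕ) (k : msg S → ℕ), 0 < b ∧ (∀ a, 2 ≤ k a) ∧ (∀ a, k a * (a : ℕ) = b) ∧
      ∀ u v, factorizationValue S u = factorizationValue S v → ∀ a, u a ≡ v a [MOD k a] := by
  obtain ⟨b, hb, huniq⟩ := h
  choose k hk2 hkb using exists_mul_mem_bettiElements hb
  have hk : ∀ a, k a * (a : ℕ) = b := fun a => huniq _ (hkb a)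
  have hb0 : 0 < b := by
    refine Nat.pos_of_ne_zero ?_
    rintro rfl
    have : Unique (factorizations S 0) :=
      { default := ⟨0, map_zero (factorizationValue S)⟩
        uniq := fun x => Subtype.ext (factorizationValue_eq_zero_iff.1 x.2) }
    exact hb.2 { preconnected := SimpleGraph.Preconnected.of_subsingleton }
  -- Removing one `a` leaves a factorization of `b - a = (k a - 1) * a`, which is unique below `b`.
  have hZ : ∀ u, factorizationValue S u = b → ∃ a, u = Finsupp.single a (k a) := by
    intro u hu
    have hu0 : u ≠ 0 := by
      rintro rfl
      rw [map_zero] at hu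
      omega
    obtain ⟨a, ha⟩ := Finsupp.ne_iff.1 hu0
    obtain ⟨w, rfl⟩ := exists_eq_add_single ha
    refine ⟨a, ?_⟩
    have hp := msg_pos a
    have h2 := hk2 a
    obtain ⟨j, hj⟩ : ∃ j, k a = j + 1 := ⟨k a - 1, by omega⟩
    have hka := hk a
    rw [hj, add_mul] at hka
    rw [factorizationValue_add_single] at hu
    rw [hj, Finsupp.single_add, factorization_unique (fun n hn => (huniq n hn).ge)
      (by omega : factorizationValue S w < b) (v := Finsupp.single a j)
      (by rw [factorizationValue_single]; omega)]
  refine ⟨b, k, hb0, hk2, hk, fun u v huv => ?_⟩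
  refine factorization_induction (r := fun u v => ∀ a, u a ≡ v a [MOD k a])
    ⟨fun _ _ => rfl, fun h a => (h a).symm, fun h h' a => (h a).trans (h' a)⟩
    (fun u v w h a => (h a).add_right _) (factorizationValue S u + 1) ?_ _
    (Nat.lt_succ_self _) u v rfl huv.symm
  intro n hn _ u v hu hv a
  rw [huniq n hn] at hu hv
  have hz : ∀ u, factorizationValue S u = b → u a ≡ 0 [MOD k a] := by
    classical
    intro u hu
    obtain ⟨c, rfl⟩ := hZ u hu
    rw [Finsupp.single_apply]
    split_ifs with hca
    · subst hca
      exact Nat.modEq_zero_iff_dvd.2 dvd_rfl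
    · rfl
  exact (hz u hu).trans (hz v hv).symm

/-! ### Linear relations over the integers -/

/-- Integer vectors, more in number than their dimension, satisfy a primitive linear relation after
scaling: a nontrivial relation `∑ γ_i V_i = 0` in which `k_i ∣ γ_i` is always forced can be
written `γ_i = k_i g_i` with some `g_i` odd. -/
theorem exists_odd_relation {ι κ : Type*} [Fintype ι] [Fintype κ]
    (hcard : Fintype.card κ < Fintype.card ι) (V : ι → κ → ℤ) (k : ι → ℤ)
    (hdvd : ∀ γ : ι → ℤ, (∑ i, γ i • V i = 0) → ∀ i, k i ∣ γ i) :
    ∃ g : ι → ℤ, (∑ i, (g i * k i) • V i = 0) ∧ ∃ i, Odd (g i) := by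
  classical
  have hdep : ¬ LinearIndependent ℤ V := fun h => by
    have := h.fintype_card_le_finrank
    rw [Module.finrank_fintype_fun_eq_card] at this
    omega
  obtain ⟨γ, hγ, i₀, hi₀⟩ := Fintype.not_linearIndependent_iff.1 hdep
  choose f hf using hdvd γ hγ
  -- After division by the gcd, the coefficients cannot all be even.
  obtain ⟨g, hg, hgcd⟩ := Finset.extract_gcd f (s := Finset.univ) ⟨i₀, Finset.mem_univ _⟩
  set D := Finset.univ.gcd f
  have hD : D ≠ 0 := by
    intro hD
    apply hi₀
    rw [hf i₀, hg i₀ (Finset.mem_univ _), hD, zero_mul, mul_zero]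
  refine ⟨g, ?_, ?_⟩
  · have : D • ∑ i, (g i * k i) • V i = 0 := by
      rw [← hγ, Finset.smul_sum]
      refine Finset.sum_congr rfl fun i _ => ?_
      rw [smul_smul, hf i, hg i (Finset.mem_univ _)]
      congr 1
      ring
    exact (smul_eq_zero.1 this).resolve_left hD
  · by_contra! hodd
    have h2 : (2 : ℤ) ∣ Finset.univ.gcd g :=
      Finset.dvd_gcd fun i _ => (Int.not_odd_iff_even.1 (hodd i)).two_dvd
    rw [hgcd] at h2
    norm_num at h2

theorem factorizationValue_eq_sum {S : AddSubmonoid ℕ} [Fintype (msg S)] (u : msg S →₀ ℕ) :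
    factorizationValue S u = ∑ a, u a * (a : ℕ) := by
  change (u.sum fun a k => k * (a : ℕ)) = _
  rw [Finsupp.sum_fintype _ _ fun a => zero_mul _]

theorem modEq_of_sum_eq {S : AddSubmonoid ℕ} [Fintype (msg S)] {k : msg S → ℕ}
    (hmod : ∀ u v, factorizationValue S u = factorizationValue S v → ∀ a, u a ≡ v a [MOD k a])
    (u v : msg S → ℕ) (h : ∑ a, u a * (a : ℕ) = ∑ a, v a * (a : ℕ)) (a : msg S) :
    u a ≡ v a [MOD k a] := by
  refine hmod (Finsupp.equivFunOnFinite.symm u) (Finsupp.equivFunOnFinite.symm v) ?_ a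
  rw [factorizationValue_eq_sum, factorizationValue_eq_sum]
  exact h

/-- The positive and negative parts of `γ` are two factorizations of one element. -/
theorem dvd_of_sum_eq_zero {S : AddSubmonoid ℕ} [Fintype (msg S)] {k : msg S → ℕ}
    (hmod : ∀ u v, factorizationValue S u = factorizationValue S v → ∀ a, u a ≡ v a [MOD k a])
    (γ : msg S → ℤ) (h : ∑ a, γ a * ((a : ℕ) : ℤ) = 0) (a : msg S) : (k a : ℤ) ∣ γ a := by
  have hpn : ∀ a, γ a = ((γ a).toNat : ℤ) - ((-γ a).toNat : ℤ) := fun a => by omega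
  have hmod' := modEq_of_sum_eq hmod (fun a => (-γ a).toNat) (fun a => (γ a).toNat) (by
    zify
    rw [← sub_eq_zero, ← Finset.sum_sub_distrib, ← neg_eq_zero, ← Finset.sum_neg_distrib, ← h]
    refine Finset.sum_congr rfl fun a _ => ?_
    conv_rhs => rw [hpn a]
    ring) a
  rw [hpn a]
  exact hmod'.dvd

/-! ### The rounding argument -/

/-- A semigroup with a unique Betti element is no quotient of a semigroup with fewer generators. -/
theorem embDim_le_of_isMultiple {S T : AddSubmonoid ℕ} (hB : HasUniqueBettiElement S)
    (hT : IsMultiple T S) : embDim S ≤ embDim T := by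
  obtain ⟨b, k, hb0, hk2, hkb, hmod⟩ := exists_modEq_of_hasUniqueBettiElement hB
  obtain ⟨d, hd, hTd⟩ := hT
  let _ : Fintype (msg S) := (msg_finite S).fintype
  let _ : Fintype (msg T) := (msg_finite T).fintype
  by_contra! hlt
  have hcard : Fintype.card (msg T) < Fintype.card (msg S) := by
    rwa [← Nat.card_eq_fintype_card, ← Nat.card_eq_fintype_card]
  have hmemT : ∀ x, x ∈ S ↔ d * x ∈ T := fun x => by rw [← hTd]; rfl
  choose V hV using fun a : msg S => mem_iff_exists_factorization.1 ((hmemT a).1 a.2.1)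
  have hVsum : ∀ a : msg S, ∑ t, (V a t : ℤ) * ((t : ℕ) : ℤ) = d * ((a : ℕ) : ℤ) := fun a => by
    rw [← Nat.cast_mul, ← hV a, factorizationValue_eq_sum]
    push_cast
    rfl
  have hcomb : ∀ c : msg S → ℤ, ∑ t : msg T, (∑ a, c a * (V a t : ℤ)) * ((t : ℕ) : ℤ)
      = d * ∑ a, c a * ((a : ℕ) : ℤ) := fun c => by
    simp_rw [Finset.sum_mul]
    rw [Finset.sum_comm, Finset.mul_sum]
    refine Finset.sum_congr rfl fun a _ => ?_
    simp_rw [mul_assoc]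
    rw [← Finset.mul_sum, hVsum]
    ring
  have hdZ : (d : ℤ) ≠ 0 := by exact_mod_cast hd
  have hrel : ∀ c : msg S → ℤ, (∀ t, ∑ a, c a * (V a t : ℤ) = 0) →
      ∑ a, c a * ((a : ℕ) : ℤ) = 0 := fun c hc => by
    have h := hcomb c
    simp_rw [hc, zero_mul, Finset.sum_const_zero] at h
    exact (mul_eq_zero.1 h.symm).resolve_left hdZ
  obtain ⟨g, hg, i₀, hi₀⟩ := exists_odd_relation hcard (fun a t => (V a t : ℤ))
    (fun a => (k a : ℤ)) fun γ hγ => dvd_of_sum_eq_zero hmod γ (hrel γ fun t => by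
      simpa using congrFun hγ t)
  have hgt : ∀ t, ∑ a, g a * k a * (V a t : ℤ) = 0 := fun t => by simpa using congrFun hg t
  have hbZ : ∀ a, (k a : ℤ) * ((a : ℕ) : ℤ) = b := fun a => by exact_mod_cast hkb a
  have hgsum : ∑ a, g a = 0 := by
    have h := hrel _ hgt
    simp_rw [mul_assoc, hbZ] at h
    rw [← Finset.sum_mul] at h
    exact (mul_eq_zero.1 h).resolve_right (by exact_mod_cast hb0.ne')
  -- `m a` is `⌈k a / 2⌉` for odd `g a` and `0` otherwise; `k a ≥ 2` keeps it below `k a`.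
  set m : msg S → ℕ := fun a => (g a % 2).toNat * ((k a + 1) / 2) with hm
  have hmlt : ∀ a, m a < k a := fun a => by
    have := hk2 a
    rcases Int.emod_two_eq_zero_or_one (g a) with h | h <;> simp only [hm, h] <;> simp <;> omega
  have hround : ∀ a, g a * k a ≤ 2 * (g a / 2 * k a + m a) := fun a => by
    have h0 := Int.mul_ediv_add_emod (g a) 2
    rcases Int.emod_two_eq_zero_or_one (g a) with h | h
    · have : m a = 0 := by simp [hm, h]
      rw [this]
      nlinarith
    · have : m a = (k a + 1) / 2 := by simp [hm, h]
      have h1 : k a ≤ 2 * m a := by omega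
      have h2 : (k a : ℤ) ≤ 2 * m a := by exact_mod_cast h1
      nlinarith
  set G := ∑ a, g a / 2 with hG
  -- As `∑ g a = 0`, twice `G` is minus the number of odd `g a`.
  have hGneg : G < 0 := by
    have h1 : 2 * G + ∑ a, g a % 2 = 0 := by
      rw [← hgsum, hG, Finset.mul_sum, ← Finset.sum_add_distrib]
      exact Finset.sum_congr rfl fun a _ => Int.mul_ediv_add_emod _ _
    have h2 : 0 < ∑ a, g a % 2 :=
      Finset.sum_pos' (fun a _ => Int.emod_nonneg _ two_ne_zero)
        ⟨i₀, Finset.mem_univ _, by rw [Int.odd_iff.1 hi₀]; exact one_pos⟩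
    omega
  set c : msg S → ℤ := fun a => g a / 2 * k a + m a with hc
  -- Rounding up against entries `V a t ≥ 0` can only increase half of the zero sum.
  have hcnonneg : ∀ t, 0 ≤ ∑ a, c a * (V a t : ℤ) := fun t => by
    have : ∑ a, g a * k a * (V a t : ℤ) ≤ 2 * ∑ a, c a * (V a t : ℤ) := by
      rw [Finset.mul_sum]
      refine Finset.sum_le_sum fun a _ => ?_
      rw [← mul_assoc]
      exact mul_le_mul_of_nonneg_right (hround a) (Nat.cast_nonneg _)
    rw [hgt] at this
    omega
  have hx0 : 0 ≤ ∑ a, c a * ((a : ℕ) : ℤ) := by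
    refine (mul_nonneg_iff_of_pos_left (by omega : (0 : ℤ) < d)).1 ?_
    rw [← hcomb]
    exact Finset.sum_nonneg fun t _ => mul_nonneg (hcnonneg t) (Nat.cast_nonneg _)
  obtain ⟨x, hx⟩ := Int.eq_ofNat_of_zero_le hx0
  have hxS : x ∈ S := by
    rw [hmemT, mem_iff_exists_factorization]
    refine ⟨Finsupp.equivFunOnFinite.symm fun t => (∑ a, c a * (V a t : ℤ)).toNat, ?_⟩
    rw [factorizationValue_eq_sum]
    zify
    rw [← hx, ← hcomb]
    refine Finset.sum_congr rfl fun t _ => ?_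
    rw [Finsupp.equivFunOnFinite_symm_apply_apply, Int.toNat_of_nonneg (hcnonneg t)]
  have hxval : (x : ℤ) = ∑ a, (m a : ℤ) * ((a : ℕ) : ℤ) + G * b := by
    rw [← hx, hG, Finset.sum_mul, ← Finset.sum_add_distrib]
    refine Finset.sum_congr rfl fun a _ => ?_
    rw [← hbZ a]
    simp only [hc]
    ring
  obtain ⟨u, hu⟩ := mem_iff_exists_factorization.1 hxS
  rw [factorizationValue_eq_sum] at hu
  -- `u a ≡ c a ≡ m a` modulo `k a`, so `m a` is the remainder of `u a`.
  have hle : ∀ a, m a ≤ u a := by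
    intro a
    have hdvd := dvd_of_sum_eq_zero hmod (fun a => (u a : ℤ) - c a) (by
      simp_rw [sub_mul]
      rw [Finset.sum_sub_distrib, hx, ← hu]
      push_cast
      exact sub_self _) a
    have h1 : (k a : ℤ) ∣ (u a : ℤ) - m a := by
      have : (u a : ℤ) - m a = (u a - c a) + k a * (g a / 2) := by
        simp only [hc]
        ring
      rw [this]
      exact dvd_add hdvd (dvd_mul_right _ _)
    have h2 : m a ≡ u a [MOD k a] := (Nat.modEq_iff_dvd).2 h1
    rw [Nat.ModEq, Nat.mod_eq_of_lt (hmlt a)] at h2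
    rw [h2]
    exact Nat.mod_le _ _
  have hsum : ∑ a, (m a : ℤ) * ((a : ℕ) : ℤ) ≤ x := by
    rw [← hu]
    push_cast
    exact Finset.sum_le_sum fun a _ =>
      mul_le_mul_of_nonneg_right (by exact_mod_cast hle a) (Nat.cast_nonneg _)
  have : G * b < 0 := mul_neg_of_neg_of_pos hGneg (by exact_mod_cast hb0)
  omega

end NumSemigroup

theorem mainTheorem4 (S : AddSubmonoid ℕ) (hS : NumSemigroup.IsNumericalSemigroup S)
    (hB : NumSemigroup.HasUniqueBettiElement S) : NumSemigroup.HasFullQuotientRank S := by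
  have hmin := NumSemigroup.quotientRank_isLeast hS
  apply le_antisymm
  · exact hmin.2 ⟨S, hS, ⟨1, one_ne_zero, by ext x; simp [NumSemigroup.quotient]⟩, rfl⟩
  · obtain ⟨T, -, hT, hrank⟩ := hmin.1
    rw [← hrank]
    exact NumSemigroup.embDim_le_of_isMultiple hB hT
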